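/- Let $H$ be a separable complex Hilbert space and let $T$ be a bounded linear operator on $H$ which is $(S+V)$-triangular, that is, $T=S+V$ with bounded operators $S,V$ such that: (i) $S$ is of scalar type: $S=\int_{\mathbb C}\lambda\,E(d\lambda)$, where $E$ is a (strongly countably additive, multiplicative, with $E(\mathbb C)=I$) spectral measure of bounded projections on the Borel sets of $\mathbb C$ such that $E(\delta)S=SE(\delta)$ and $\sigma(S|_{E(\delta)H})\subseteq\overline{\delta}$ for every Borel set $\delta$; (ii) $V$ is compact and quasinilpotent, i.e. $\sigma(V)\subseteq\{0\}$; (iii) there is a maximal chain of orthogonal projections $E_t$ $(a\le t\le b)$, i.e. an increasing family with $E_a=0$, $E_b=I$, $\dim (E_{t+0}-E_{t-0})H\le 1$ for $a<t<b$, $\dim (E_{a+0}-E_a)H\le1$ and $\dim (E_b-E_{b-0})H\le 1$ (one-sided limits in the strong sense), such that $E_tS=SE_t$ and $E_tVE_t=VE_t$ for $a<t<b$ (the subspaces $E_tH$ reduce $S$ and are invariant under $V$); (A) $(S-\lambda I)^{-1}V$ is quasinilpotent for every $\lambda\notin\sigma(S)$; (B) $(T-\lambda I)^{-1}V$ is quasinilpotent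 for every $\lambda\notin\sigma(T)$. Let $f$ be a function which is analytic in some open neighbourhood of $\sigma(T)$, and let $$f(T)=\frac1{2\pi i}\int_C f(\lambda)(\lambda I-T)^{-1}\,d\lambda ,$$ where $C$ is any contour (a finite family of closed piecewise $C^1$ curves) surrounding $\sigma(T)$ in an open neighbourhood $U\supseteq\sigma(T)$ on which $f$ is analytic: $C\subset U\setminus\sigma(T)$, and $C$ has winding number $1$ about every point of $\sigma(T)$ and $0$ about every point outside $U$. Such contours exist, the operator $f(T)$ does not depend on the choice of $U$ and $C$, and $$\sigma(f(T))=f(\sigma(T)).$$ -/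

import Mathlib

open MeasureTheory Topology Filter
open scoped InnerProductSpace

noncomputable section

/-- A bounded operator is quasinilpotent if its spectrum is concentrated at zero
(on the zero space the spectrum is empty). -/
def IsQuasinilpotent {H : Type*} [NormedAddCommGroup H] [InnerProductSpace ℂ H]
    (N : H →L[ℂ] H) : Prop :=
  spectrum ℂ N ⊆ {0}

/-! ### Spectral measures and operators of scalar type -/

/-- A spectral measure on the Borel sets of `ℂ` in the sense of Dunford: a multiplicative, strongly
countably additive family of bounded projections (not necessarily orthogonal) with total mass the
identity. The relations `E ∅ = 0` and `E δ * E δ = E δ` follow from the fields. The values at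
non-Borel sets are irrelevant. -/
structure SpectralMeasure (H : Type*) [NormedAddCommGroup H] [InnerProductSpace ℂ H] where
  /-- The projection attached to a set. -/
  proj : Set ℂ → H →L[ℂ] H
  proj_univ : proj Set.univ = 1
  proj_inter : ∀ δ ε : Set ℂ, MeasurableSet δ → MeasurableSet ε →
    proj (δ ∩ ε) = proj δ * proj ε
  hasSum_proj : ∀ δ : ℕ → Set ℂ, (∀ i, MeasurableSet (δ i)) →
    Pairwise (Function.onFun Disjoint δ) →
    ∀ x : H, HasSum (fun i => proj (δ i) x) (proj (⋃ i, δ i) x)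

namespace SpectralMeasure

variable {H : Type*} [NormedAddCommGroup H] [InnerProductSpace ℂ H]

theorem proj_empty (E : SpectralMeasure H) : E.proj ∅ = 0 := by
  ext x
  have h := E.hasSum_proj (fun _ => ∅) (fun _ => MeasurableSet.empty)
    (fun _ _ _ => by simp [Function.onFun]) x
  have h2 := h.summable.tendsto_atTop_zero
  exact tendsto_nhds_unique tendsto_const_nhds h2

open Classical in
/-- The complex Borel measure `δ ↦ ⟪y, E(δ) x⟫`. -/
def complexMeasure (E : SpectralMeasure H) (x y : H) : ComplexMeasure ℂ where
  measureOf' δ := if MeasurableSet δ then ⟪y, E.proj δ x⟫_ℂ else 0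
  empty' := by simp [E.proj_empty]
  not_measurable' _ h := by simp [h]
  m_iUnion' δ hδ hd := by
    have h := (E.hasSum_proj δ hδ hd x).mapL (innerSL ℂ y)
    simpa [hδ, MeasurableSet.iUnion hδ] using h

/-- If `S` commutes with `E(δ)`, this is the restriction `S_δ` of `S` to the subspace `E(δ) H`. -/
def part (E : SpectralMeasure H) (S : H →L[ℂ] H) (δ : Set ℂ)
    (h : E.proj δ * S = S * E.proj δ) :
    LinearMap.range (E.proj δ : H →ₗ[ℂ] H) →L[ℂ] LinearMap.range (E.proj δ : H →ₗ[ℂ] H) :=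
  (S.comp (LinearMap.range (E.proj δ : H →ₗ[ℂ] H)).subtypeL).codRestrict
    (LinearMap.range (E.proj δ : H →ₗ[ℂ] H)) (by
      rintro ⟨_, z, rfl⟩
      exact ⟨S z, DFunLike.congr_fun h z⟩)

/-- `E` is a resolution of the identity for `S`: `E(δ) S = S E(δ)` and `σ(S_δ) ⊆ closure δ` for
all Borel sets `δ`. -/
structure IsResolutionOfIdentity (E : SpectralMeasure H) (S : H →L[ℂ] H) : Prop where
  commute : ∀ δ : Set ℂ, MeasurableSet δ → E.proj δ * S = S * E.proj δ
  spectrum_part_subset : ∀ (δ : Set ℂ) (hδ : MeasurableSet δ),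
    spectrum ℂ (E.part S δ (commute δ hδ)) ⊆ closure δ

/-- `S = ∫ z E(dz)`, in the weak sense: `⟪y, S x⟫ = ∫ z ⟪y, E(dz) x⟫` for all `x`, `y`. -/
def IsIntegralId (E : SpectralMeasure H) (S : H →L[ℂ] H) : Prop :=
  ∀ x y : H, (E.complexMeasure x y).Integrable (fun z : ℂ => z) ∧
    ⟪y, S x⟫_ℂ = VectorMeasure.integral (E.complexMeasure x y) (fun z : ℂ => z)
      (ContinuousLinearMap.mul ℝ ℂ)

end SpectralMeasure

/-- An operator of scalar type: `S = ∫ z E(dz)` with `E` a resolution of the identity for `S`. -/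
def IsScalarType {H : Type*} [NormedAddCommGroup H] [InnerProductSpace ℂ H]
    (S : H →L[ℂ] H) : Prop :=
  ∃ E : SpectralMeasure H, E.IsResolutionOfIdentity S ∧ E.IsIntegralId S

/-! ### Maximal chains and triangular operators -/

section Chain

variable {H : Type*} [NormedAddCommGroup H] [InnerProductSpace ℂ H] [CompleteSpace H]

/-- `P` is the strong limit of the operators `E s` along the filter `l`. -/
def IsStrongLimit (E : ℝ → H →L[ℂ] H) (l : Filter ℝ) (P : H →L[ℂ] H) : Prop :=
  ∀ x : H, Tendsto (fun s => E s x) l (𝓝 (P x))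

/-- `E t`, `a ≤ t ≤ b`, is a maximal chain of orthogonal projections: it is increasing,
`E a = 0`, `E b = 1`, and its jumps `E_{a+0} - E_a`, `E_{t+0} - E_{t-0}` and `E_b - E_{b-0}` have
rank at most one. The one-sided limits are strong limits (they exist by monotonicity). -/
structure IsMaximalChain (a b : ℝ) (E : ℝ → H →L[ℂ] H) : Prop where
  lt : a < b
  isStarProjection : ∀ t ∈ Set.Icc a b, IsStarProjection (E t)
  mono : ∀ s ∈ Set.Icc a b, ∀ t ∈ Set.Icc a b, s ≤ t →
    LinearMap.range (E s : H →ₗ[ℂ] H) ≤ LinearMap.range (E t : H →ₗ[ℂ] H)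
  left_eq : E a = 0
  right_eq : E b = 1
  jump_left : ∃ P, IsStrongLimit E (𝓝[>] a) P ∧ LinearMap.rank (P - E a : H →ₗ[ℂ] H) ≤ 1
  jump_right : ∃ P, IsStrongLimit E (𝓝[<] b) P ∧ LinearMap.rank (E b - P : H →ₗ[ℂ] H) ≤ 1
  jump : ∀ t ∈ Set.Ioo a b, ∃ P Q, IsStrongLimit E (𝓝[>] t) P ∧ IsStrongLimit E (𝓝[<] t) Q ∧
    LinearMap.rank (P - Q : H →ₗ[ℂ] H) ≤ 1

/-- The decomposition `T = S + N` exhibits `T` as an `(S+N)`-triangular operator: `S` is of scalar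
type, `N` is quasinilpotent, for some maximal chain of orthogonal projections `S` commutes with all
projections of the chain and `N` leaves all subspaces of the chain invariant, and the operators
`(S - z)⁻¹ N` and `(T - z)⁻¹ N` are quasinilpotent at all regular points `z` of `S` and `T`. -/
structure IsTriangularDecomposition (T S N : H →L[ℂ] H) : Prop where
  scalarType : IsScalarType S
  quasinilpotent : IsQuasinilpotent N
  eq_add : T = S + N
  chain : ∃ (a b : ℝ) (E : ℝ → H →L[ℂ] H), IsMaximalChain a b E ∧
    ∀ t ∈ Set.Ioo a b, E t * S = S * E t ∧ E t * N * E t = N * E t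
  condA : ∀ z ∈ resolventSet ℂ S, IsQuasinilpotent (Ring.inverse (S - z • 1) * N)
  condB : ∀ z ∈ resolventSet ℂ T, IsQuasinilpotent (Ring.inverse (T - z • 1) * N)

/-- `T` is `(S+N)`-triangular. -/
def IsSNTriangular (T : H →L[ℂ] H) : Prop :=
  ∃ S N : H →L[ℂ] H, IsTriangularDecomposition T S N

/-- `T` is `(S+V)`-triangular: `(S+N)`-triangular with a compact quasinilpotent part. -/
def IsSVTriangular (T : H →L[ℂ] H) : Prop :=
  ∃ S V : H →L[ℂ] H, IsTriangularDecomposition T S V ∧ IsCompactOperator V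

end Chain

/-! ### Contours and the Riesz–Dunford integral -/

/-- A contour in `ℂ`: finitely many closed piecewise `C¹` curves. They are cut into `C¹` arcs, and
the arc `i` is followed by the arc `next i`, so the cycles of the permutation `next` are the closed
curves. -/
structure Contour where
  /-- The number of arcs. -/
  n : ℕ
  /-- The initial points of the arcs. -/
  src : Fin n → ℂ
  /-- The end points of the arcs. -/
  tgt : Fin n → ℂ
  /-- The arcs, parametrized by the unit interval. -/
  arc : ∀ i, Path (src i) (tgt i)
  contDiffOn_arc : ∀ i, ContDiffOn ℝ 1 (arc i).extend (Set.Icc 0 1)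
  /-- The arc that follows a given one. -/
  next : Equiv.Perm (Fin n)
  tgt_eq : ∀ i, tgt i = src (next i)

namespace Contour

/-- The set of points on the contour. -/
def trace (Γ : Contour) : Set ℂ := ⋃ i, Set.range (Γ.arc i)

/-- The integral `∮_Γ F(z) dz`. -/
def integral {B : Type*} [NormedAddCommGroup B] [NormedSpace ℂ B] (Γ : Contour) (F : ℂ → B) : B :=
  ∑ i, curveIntegral (fun z => ContinuousLinearMap.toSpanSingleton ℂ (F z)) (Γ.arc i)

/-- The winding number `(2πi)⁻¹ ∮_Γ dz / (z - w)` (for `w` not on the contour). -/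
def windingNumber (Γ : Contour) (w : ℂ) : ℂ :=
  (2 * Real.pi * Complex.I)⁻¹ * Γ.integral (fun z => (z - w)⁻¹)

/-- `Γ` surrounds `K` in `U`: it lies in `U \ K`, it has winding number one about each point
of `K` and winding number zero about each point outside `U`. -/
structure Surrounds (Γ : Contour) (K U : Set ℂ) : Prop where
  trace_subset : Γ.trace ⊆ U \ K
  windingNumber_eq_one : ∀ w ∈ K, Γ.windingNumber w = 1
  windingNumber_eq_zero : ∀ w ∉ U, Γ.windingNumber w = 0

/-- The Riesz–Dunford integral `(2πi)⁻¹ ∮_Γ f(z) (z - T)⁻¹ dz`. -/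
def rieszDunford {H : Type*} [NormedAddCommGroup H] [InnerProductSpace ℂ H] (Γ : Contour)
    (T : H →L[ℂ] H) (f : ℂ → ℂ) : H →L[ℂ] H :=
  (2 * Real.pi * Complex.I : ℂ)⁻¹ • Γ.integral (fun z => f z • resolvent T z)

end Contour

/-- `A` is a value of `f(T)`: it is the Riesz–Dunford integral over a contour which surrounds the
spectrum of `T` in an open neighbourhood of the spectrum on which `f` is analytic. -/
def IsFunctionOfOperator {H : Type*} [NormedAddCommGroup H] [InnerProductSpace ℂ H]
    (T : H →L[ℂ] H) (f : ℂ → ℂ) (A : H →L[ℂ] H) : Prop :=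
  ∃ (U : Set ℂ) (Γ : Contour), IsOpen U ∧ spectrum ℂ T ⊆ U ∧ AnalyticOnNhd ℂ f U ∧
    Γ.Surrounds (spectrum ℂ T) U ∧ A = Γ.rieszDunford T f

end

/-!
The theorem is an instance of the holomorphic functional calculus of a bounded operator. It rests on
the homological form of Cauchy's theorem and on the existence of surrounding contours, both proved
from scratch.

*Cauchy's theorem.* A `WeightedCycle` is a finite family of `C¹` curves with complex multiplicities
and zero boundary; differences of contours are of this kind. Following Dixon, for `F` holomorphic
on an open set `Ω` that contains the cycle, the function `z ↦ ∮ (F(w) - F(z)) / (w - z) dw` on `Ω`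
is continued by `z ↦ ∮ F(w) / (w - z) dw` outside `Ω`. If the index vanishes off `Ω`, the result is
entire and tends to zero at infinity, so it is zero by Liouville's theorem
(`WeightedCycle.integral_dslope_eq_zero`). This gives Cauchy's theorem
(`WeightedCycle.integral_eq_zero`) and integral formula (`WeightedCycle.integral_inv_sub_smul`) for
functions with values in a Banach space.

*Independence of the contour.* For contours `Γ` in `U` and `Δ` in `V`, the cycle `Γ - Δ` has index
zero about all points outside `(U ∪ V) \ σ(T)`, where `z ↦ f(z) (z - T)⁻¹` is holomorphic
(`IsFunctionOfOperator.unique`).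

*Existence of contours.* In a fine square grid, the edges that separate the squares which meet `K`
from those which do not are closed up to curves by a permutation of the edges, because every vertex
is the origin of as many of them as it is the end of. Integrals over these edges are sums of
integrals over boundaries of squares, which gives the winding numbers
(`exists_contour_surrounds`).

*Spectral mapping.* The double commutant of `T` is a commutative Banach algebra in which
inverses, hence spectra, are those of the whole algebra. It contains `f(T)`, and by Cauchy's
formula every character `ψ` satisfies `ψ(f(T)) = (2πi)⁻¹ ∮ f(z) / (z - ψ(T)) dz = f(ψ(T))`; by
Gelfand theory the spectrum of an element is the set of values of the characters at it
(`spectrum_integral_resolvent`).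
-/

/-! ### Cycles and their integrals -/

/-- A `C¹` cycle in `ℂ` with complex multiplicities: a finite family of curves, parametrized by the
unit interval, such that the weighted sum of their boundaries is zero. The latter is expressed by
testing against all functions on `ℂ`. The values of the curves outside `[0, 1]` are irrelevant. -/
structure WeightedCycle (ι : Type*) [Fintype ι] where
  /-- The curves, parametrized by the unit interval. -/
  curve : ι → ℝ → ℂ
  /-- The multiplicities of the curves. -/
  weight : ι → ℂ
  contDiffOn_curve : ∀ i, ContDiffOn ℝ 1 (curve i) (Set.Icc 0 1)
  sum_boundary : ∀ g : ℂ → ℂ, ∑ i, weight i * (g (curve i 1) - g (curve i 0)) = 0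

namespace WeightedCycle

variable {ι : Type*} [Fintype ι] (C : WeightedCycle ι)
  {E : Type*} [NormedAddCommGroup E] [NormedSpace ℂ E]

/-- The set of points on the curves of the cycle. -/
def support : Set ℂ := ⋃ i, C.curve i '' Set.Icc 0 1

/-- The integral `∮_C F(z) dz`, the weighted sum of the integrals over the curves. -/
noncomputable def integral (F : ℂ → E) : E :=
  ∑ i, C.weight i • ∫ t in (0 : ℝ)..1, derivWithin (C.curve i) (Set.Icc 0 1) t • F (C.curve i t)

theorem continuousOn_curve (i : ι) : ContinuousOn (C.curve i) (Set.Icc 0 1) :=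
  (C.contDiffOn_curve i).continuousOn

theorem continuousOn_derivWithin_curve (i : ι) :
    ContinuousOn (derivWithin (C.curve i) (Set.Icc 0 1)) (Set.Icc 0 1) :=
  (C.contDiffOn_curve i).continuousOn_derivWithin (uniqueDiffOn_Icc zero_lt_one) le_rfl

theorem curve_mem_support (i : ι) {t : ℝ} (ht : t ∈ Set.Icc (0 : ℝ) 1) : C.curve i t ∈ C.support :=
  Set.mem_iUnion.2 ⟨i, t, ht, rfl⟩

theorem isCompact_support : IsCompact C.support :=
  isCompact_iUnion fun i => isCompact_Icc.image_of_continuousOn (C.continuousOn_curve i)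

variable {C}

theorem continuousOn_integrand {F : ℂ → E} (hF : ContinuousOn F C.support) (i : ι) :
    ContinuousOn (fun t => derivWithin (C.curve i) (Set.Icc 0 1) t • F (C.curve i t))
      (Set.Icc 0 1) :=
  (C.continuousOn_derivWithin_curve i).smul
    (hF.comp (C.continuousOn_curve i) fun _ ht => C.curve_mem_support i ht)

theorem intervalIntegrable {F : ℂ → E} (hF : ContinuousOn F C.support) (i : ι) :
    IntervalIntegrable (fun t => derivWithin (C.curve i) (Set.Icc 0 1) t • F (C.curve i t))
      volume 0 1 :=
  ContinuousOn.intervalIntegrable_of_Icc zero_le_one (continuousOn_integrand hF i)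

theorem integral_congr {F G : ℂ → E} (h : Set.EqOn F G C.support) :
    C.integral F = C.integral G := by
  refine Finset.sum_congr rfl fun i _ => congrArg _ (intervalIntegral.integral_congr fun t ht => ?_)
  rw [Set.uIcc_of_le zero_le_one] at ht
  simp only [h (C.curve_mem_support i ht)]

theorem integral_sub {F G : ℂ → E} (hF : ContinuousOn F C.support)
    (hG : ContinuousOn G C.support) :
    C.integral (fun z => F z - G z) = C.integral F - C.integral G := by
  simp only [integral, smul_sub, ← Finset.sum_sub_distrib]
  refine Finset.sum_congr rfl fun i _ => ?_
  rw [← smul_sub, ← intervalIntegral.integral_sub (intervalIntegrable hF i)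
    (intervalIntegrable hG i)]

theorem integral_smul_const [CompleteSpace E] (F : ℂ → ℂ) (v : E) :
    C.integral (fun z => F z • v) = C.integral F • v := by
  simp only [integral, Finset.sum_smul, smul_assoc]
  refine Finset.sum_congr rfl fun i _ => ?_
  rw [← intervalIntegral.integral_smul_const]
  simp [smul_smul]

theorem _root_.ContinuousLinearMap.weightedCycle_integral_comm
    {E' : Type*} [NormedAddCommGroup E'] [NormedSpace ℂ E'] [CompleteSpace E] [CompleteSpace E']
    (ℓ : E →L[ℂ] E') {F : ℂ → E} (hF : ContinuousOn F C.support) :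
    C.integral (fun z => ℓ (F z)) = ℓ (C.integral F) := by
  simp only [integral, map_sum, map_smul]
  refine Finset.sum_congr rfl fun i _ => ?_
  rw [← ContinuousLinearMap.intervalIntegral_comp_comm _ (intervalIntegrable hF i)]
  simp

theorem integral_curve_eq_sub (i : ι) {F G : ℂ → ℂ} (hF : ContinuousOn F C.support)
    (hG : ∀ t ∈ Set.Icc (0 : ℝ) 1, HasDerivAt G (F (C.curve i t)) (C.curve i t)) :
    ∫ t in (0 : ℝ)..1, derivWithin (C.curve i) (Set.Icc 0 1) t • F (C.curve i t) =
      G (C.curve i 1) - G (C.curve i 0) := by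
  refine intervalIntegral.integral_eq_sub_of_hasDeriv_right_of_le zero_le_one
    (f := fun t => G (C.curve i t)) ?_ ?_ (intervalIntegrable hF i)
  · exact fun t ht => ContinuousAt.comp_continuousWithinAt (hG t ht).continuousAt
      (C.continuousOn_curve i t ht)
  · intro t ht
    have ht' := Set.Ioo_subset_Icc_self ht
    have h1 : HasDerivAt (C.curve i) (derivWithin (C.curve i) (Set.Icc 0 1) t) t :=
      (((C.contDiffOn_curve i).differentiableOn one_ne_zero t ht').hasDerivWithinAt).hasDerivAt
        (Icc_mem_nhds ht.1 ht.2)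
    exact ((hG t ht').scomp t h1).hasDerivWithinAt

/-- The fundamental theorem of calculus: a function with a primitive has zero integral over a
cycle. -/
theorem integral_eq_zero_of_hasDerivAt {F G : ℂ → ℂ} (hF : ContinuousOn F C.support)
    (hG : ∀ z ∈ C.support, HasDerivAt G (F z) z) : C.integral F = 0 := by
  rw [← C.sum_boundary G, integral]
  refine Finset.sum_congr rfl fun i _ => ?_
  rw [smul_eq_mul, integral_curve_eq_sub i hF fun t ht => hG _ (C.curve_mem_support i ht)]

/-- Differentiation under the integral sign for a locally bounded family that depends
holomorphically on the parameter. No bound on the derivative is needed, as Cauchy's estimate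
provides one. -/
theorem hasDerivAt_integral_param [CompleteSpace E] {Φ : ℂ → ℂ → E} {z₀ : ℂ} {r M : ℝ} (hr : 0 < r)
    (hc : ∀ z ∈ Metric.ball z₀ r, ContinuousOn (Φ z) C.support)
    (hd : ∀ w ∈ C.support, DifferentiableOn ℂ (fun z => Φ z w) (Metric.ball z₀ r))
    (hM : ∀ z ∈ Metric.ball z₀ r, ∀ w ∈ C.support, ‖Φ z w‖ ≤ M) :
    HasDerivAt (fun z => C.integral (Φ z))
      (C.integral fun w => deriv (fun z => Φ z w) z₀) z₀ := by
  have hr2 : 0 < r / 2 := by positivity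
  have hderiv : ∀ w ∈ C.support, ∀ z ∈ Metric.ball z₀ (r / 2),
      HasDerivAt (fun z => Φ z w) (deriv (fun z => Φ z w) z) z := fun w hw z hz =>
    ((hd w hw).differentiableAt (Metric.isOpen_ball.mem_nhds
      (Metric.ball_subset_ball (by linarith) hz))).hasDerivAt
  have hbound : ∀ w ∈ C.support, ∀ z ∈ Metric.ball z₀ (r / 2),
      ‖deriv (fun z => Φ z w) z‖ ≤ M / (r / 4) := by
    intro w hw z hz
    have hsub : Metric.closedBall z (r / 4) ⊆ Metric.ball z₀ r :=
      Metric.closedBall_subset_ball' (by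
        rw [Metric.mem_ball] at hz; linarith)
    refine Complex.norm_deriv_le_of_forall_mem_sphere_norm_le (by positivity) ?_
      fun y hy => hM y (hsub (Metric.sphere_subset_closedBall hy)) w hw
    exact ((hd w hw).mono hsub).diffContOnCl_ball subset_rfl
  unfold integral
  refine HasDerivAt.fun_sum fun i _ => HasDerivAt.const_smul _ ?_
  obtain ⟨B, hB⟩ := isCompact_Icc.exists_bound_of_continuousOn (C.continuousOn_derivWithin_curve i)
  have hΙ : ∀ t ∈ Set.uIoc (0 : ℝ) 1, t ∈ Set.Icc (0 : ℝ) 1 := fun t ht => by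
    rw [Set.uIoc_of_le zero_le_one] at ht
    exact Set.Ioc_subset_Icc_self ht
  have hmeas : ∀ G : ℂ → E, ContinuousOn G C.support → AEStronglyMeasurable
      (fun t => derivWithin (C.curve i) (Set.Icc 0 1) t • G (C.curve i t))
      (volume.restrict (Set.uIoc 0 1)) := fun G hG =>
    ((continuousOn_integrand hG i).mono hΙ).aestronglyMeasurable measurableSet_uIoc
  refine (intervalIntegral.hasDerivAt_integral_of_dominated_loc_of_deriv_le
    (bound := fun _ => B * (M / (r / 4))) (s := Metric.ball z₀ (r / 2))
    (F' := fun z t => derivWithin (C.curve i) (Set.Icc 0 1) t •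
      deriv (fun z => Φ z (C.curve i t)) z)
    (Metric.ball_mem_nhds _ hr2) ?_ (intervalIntegrable (hc z₀ (Metric.mem_ball_self hr)) i)
    ?_ ?_ intervalIntegrable_const ?_).2
  · filter_upwards [Metric.ball_mem_nhds z₀ hr] with z hz using hmeas _ (hc z hz)
  · -- the derivative is a pointwise limit of difference quotients, so it is measurable
    classical
    refine aestronglyMeasurable_of_tendsto_ae (𝓝[≠] z₀)
      (f := fun z t => if z ∈ Metric.ball z₀ r then
        derivWithin (C.curve i) (Set.Icc 0 1) t • slope (fun z => Φ z (C.curve i t)) z₀ z else 0)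
      (fun z => ?_) ?_
    · by_cases hz : z ∈ Metric.ball z₀ r
      · simp only [hz, if_true]
        exact hmeas (fun w => slope (fun z => Φ z w) z₀ z)
          (((hc z hz).sub (hc z₀ (Metric.mem_ball_self hr))).const_smul (z - z₀)⁻¹)
      · simp only [hz, if_false]
        exact aestronglyMeasurable_const
    · refine (ae_restrict_iff' measurableSet_uIoc).2 (Eventually.of_forall fun t ht => ?_)
      have h := (hasDerivAt_iff_tendsto_slope.1 (hderiv _ (C.curve_mem_support i (hΙ t ht)) z₀
        (Metric.mem_ball_self hr2))).const_smul (derivWithin (C.curve i) (Set.Icc 0 1) t)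
      refine h.congr' ?_
      filter_upwards [mem_nhdsWithin_of_mem_nhds (Metric.ball_mem_nhds z₀ hr)] with z hz
      simp only [hz, if_true]
  · refine Eventually.of_forall fun t ht z hz => ?_
    rw [norm_smul]
    exact mul_le_mul (hB t (hΙ t ht)) (hbound _ (C.curve_mem_support i (hΙ t ht)) z hz)
      (norm_nonneg _) ((norm_nonneg _).trans (hB t (hΙ t ht)))
  · exact Eventually.of_forall fun t ht z hz =>
      (hderiv _ (C.curve_mem_support i (hΙ t ht)) z hz).const_smul _

variable (C) in
/-- The index `∮_C dw / (w - z)` of the cycle about a point off the cycle, without the factor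
`(2πi)⁻¹`. -/
noncomputable def index (z : ℂ) : ℂ := C.integral fun w => (w - z)⁻¹

end WeightedCycle

/-! ### Dixon's proof of the homological Cauchy theorem -/

theorem dslope_comm {𝕜 E : Type*} [NontriviallyNormedField 𝕜] [NormedAddCommGroup E]
    [NormedSpace 𝕜 E] (f : 𝕜 → E) (a b : 𝕜) : dslope f a b = dslope f b a := by
  rcases eq_or_ne a b with rfl | h
  · rfl
  · rw [dslope_of_ne _ h.symm, dslope_of_ne _ h, slope_comm]

namespace WeightedCycle

variable {ι : Type*} [Fintype ι] {C : WeightedCycle ι}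
  {E : Type*} [NormedAddCommGroup E] [NormedSpace ℂ E]

variable (C) in
theorem exists_norm_integral_le (E : Type*) [NormedAddCommGroup E] [NormedSpace ℂ E] :
    ∃ L : ℝ, ∀ (F : ℂ → E) (M : ℝ), (∀ z ∈ C.support, ‖F z‖ ≤ M) → ‖C.integral F‖ ≤ L * M := by
  choose B hB using fun i =>
    isCompact_Icc.exists_bound_of_continuousOn (C.continuousOn_derivWithin_curve i)
  refine ⟨∑ i, ‖C.weight i‖ * B i, fun F M hM => ?_⟩
  rw [integral, Finset.sum_mul]
  refine norm_sum_le_of_le _ fun i _ => ?_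
  rw [norm_smul, mul_assoc]
  refine mul_le_mul_of_nonneg_left ?_ (norm_nonneg _)
  have := intervalIntegral.norm_integral_le_of_norm_le_const (a := 0) (b := 1) (C := B i * M)
    (f := fun t => derivWithin (C.curve i) (Set.Icc 0 1) t • F (C.curve i t)) (fun t ht => ?_)
  · simpa using this
  · rw [Set.uIoc_of_le zero_le_one] at ht
    have ht' := Set.Ioc_subset_Icc_self ht
    rw [norm_smul]
    exact mul_le_mul (hB i t ht') (hM _ (C.curve_mem_support i ht')) (norm_nonneg _)
      ((norm_nonneg _).trans (hB i t ht'))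

theorem continuousOn_inv_sub {z : ℂ} (hz : z ∉ C.support) :
    ContinuousOn (fun w => (w - z)⁻¹) C.support :=
  ContinuousOn.inv₀ (by fun_prop) fun w hw h => hz (sub_eq_zero.1 h ▸ hw)

/-- The Cauchy transform `z ↦ ∮ F(w) / (w - z) dw` is holomorphic off the cycle. -/
theorem hasDerivAt_cauchyTransform [CompleteSpace E] {F : ℂ → E} (hF : ContinuousOn F C.support)
    {z₀ : ℂ} (hz₀ : z₀ ∉ C.support) :
    HasDerivAt (fun z => C.integral fun w => (w - z)⁻¹ • F w)
      (C.integral fun w => ((w - z₀) ^ 2)⁻¹ • F w) z₀ := by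
  obtain ⟨r, hr, hsub⟩ := Metric.isOpen_iff.1 C.isCompact_support.isClosed.isOpen_compl z₀ hz₀
  have hr2 : 0 < r / 2 := by positivity
  have hball : ∀ z ∈ Metric.ball z₀ (r / 2), ∀ w ∈ C.support, r / 2 ≤ ‖w - z‖ := by
    intro z hz w hw
    have h1 : r ≤ dist w z₀ := by
      by_contra! h
      exact hsub (Metric.mem_ball.2 h) hw
    have h2 := dist_triangle w z z₀
    rw [Metric.mem_ball] at hz
    rw [← dist_eq_norm]
    linarith
  have hne : ∀ z ∈ Metric.ball z₀ (r / 2), ∀ w ∈ C.support, w - z ≠ 0 := fun z hz w hw h => by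
    have := hball z hz w hw
    rw [h, norm_zero] at this
    linarith
  have hderiv : ∀ w ∈ C.support, ∀ z ∈ Metric.ball z₀ (r / 2),
      HasDerivAt (fun z => (w - z)⁻¹ • F w) (((w - z) ^ 2)⁻¹ • F w) z := fun w hw z hz => by
    have h := (((hasDerivAt_id z).const_sub w).fun_inv (hne z hz w hw)).smul_const (F w)
    simpa using h
  obtain ⟨B, hB⟩ := C.isCompact_support.exists_bound_of_continuousOn hF
  have key := hasDerivAt_integral_param (C := C) (Φ := fun z w => (w - z)⁻¹ • F w)
    (M := (r / 2)⁻¹ * B) hr2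
    (fun z hz => (continuousOn_inv_sub fun h => hne z hz z h (sub_self z)).smul hF)
    (fun w hw z hz => (hderiv w hw z hz).differentiableAt.differentiableWithinAt)
    (fun z hz w hw => ?_)
  · rwa [integral_congr fun w hw => (hderiv w hw z₀ (Metric.mem_ball_self hr2)).deriv] at key
  · rw [norm_smul, norm_inv]
    exact mul_le_mul (inv_anti₀ hr2 (hball z hz w hw)) (hB w hw) (norm_nonneg _) (by positivity)

theorem hasDerivAt_index {z : ℂ} (hz : z ∉ C.support) : HasDerivAt C.index 0 z := by
  have h := hasDerivAt_cauchyTransform (C := C) (F := fun _ => (1 : ℂ)) continuousOn_const hz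
  simp only [smul_eq_mul, mul_one] at h
  have h0 : ∀ w ∈ C.support, w - z ≠ 0 := fun w hw h => hz (sub_eq_zero.1 h ▸ hw)
  have h2 : C.integral (fun w => ((w - z) ^ 2)⁻¹) = 0 := by
    refine integral_eq_zero_of_hasDerivAt (G := fun w => -(w - z)⁻¹)
      (ContinuousOn.inv₀ (by fun_prop) fun w hw => pow_ne_zero _ (h0 w hw)) fun w hw => ?_
    have := (((hasDerivAt_id w).sub_const z).fun_inv (h0 w hw)).fun_neg
    simpa [neg_div] using this
  rwa [h2] at h

/-- The index is constant on convex open sets which do not meet the cycle. -/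
theorem index_eq_of_convex {s : Set ℂ} (hs : Convex ℝ s) (hso : IsOpen s)
    (hsC : Disjoint s C.support) {z w : ℂ} (hz : z ∈ s) (hw : w ∈ s) : C.index z = C.index w := by
  have hd : ∀ x ∈ s, HasDerivAt C.index 0 x := fun x hx =>
    hasDerivAt_index (Set.disjoint_left.1 hsC hx)
  exact hso.is_const_of_deriv_eq_zero hs.isPreconnected
    (fun x hx => (hd x hx).differentiableAt.differentiableWithinAt)
    (fun x hx => (hd x hx).deriv) hz hw

/-- The index vanishes about the points that are separated from the cycle by a line. -/
theorem index_eq_zero_of_re_pos {z a : ℂ} (h : ∀ w ∈ C.support, 0 < (a * (w - z)).re) :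
    C.index z = 0 := by
  have hne : ∀ w ∈ C.support, w - z ≠ 0 := fun w hw h0 => by simpa [h0] using h w hw
  refine integral_eq_zero_of_hasDerivAt (G := fun w => Complex.log (a * (w - z)))
    (ContinuousOn.inv₀ (by fun_prop) hne) fun w hw => ?_
  have ha : a ≠ 0 := by rintro rfl; simpa using h w hw
  have h1 := (((hasDerivAt_id' w).sub_const z).const_mul a).clog (Or.inl (h w hw))
  convert h1 using 1
  rw [mul_one, div_mul_cancel_left₀ ha]

/-- For large `z` the cycle lies in the half-plane `Re (z̄ w) < |z|²`. -/
theorem index_eq_zero_of_support_subset_ball {R : ℝ} (hR : C.support ⊆ Metric.ball 0 R) {z : ℂ}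
    (hz : R ≤ ‖z‖) : C.index z = 0 := by
  refine index_eq_zero_of_re_pos (a := -(starRingEnd ℂ z)) fun w hw => ?_
  have hw' : ‖w‖ < R := by simpa using hR hw
  have h1 : (starRingEnd ℂ z * w).re < ‖z‖ * ‖z‖ :=
    calc (starRingEnd ℂ z * w).re ≤ ‖starRingEnd ℂ z * w‖ := Complex.re_le_norm _
      _ = ‖z‖ * ‖w‖ := by rw [norm_mul, Complex.norm_conj]
      _ < ‖z‖ * ‖z‖ := mul_lt_mul_of_pos_left (hw'.trans_le hz)
          ((norm_nonneg w).trans_lt (hw'.trans_le hz))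
  have h2 : (starRingEnd ℂ z * z).re = ‖z‖ * ‖z‖ := by
    rw [mul_comm, Complex.mul_conj, Complex.normSq_eq_norm_sq, Complex.ofReal_re, sq]
  rw [neg_mul, Complex.neg_re, mul_sub, Complex.sub_re]
  linarith

/-- The difference quotients `(F(w) - F(z)) / (w - z)` are bounded uniformly in `w ∈ K`, locally
uniformly in `z`, including near the diagonal. -/
theorem exists_norm_dslope_le [CompleteSpace E] {F : ℂ → E} {Ω K : Set ℂ} (hΩ : IsOpen Ω)
    (hF : DifferentiableOn ℂ F Ω) (hK : IsCompact K) (hKΩ : K ⊆ Ω) {z₀ : ℂ} (hz₀ : z₀ ∈ Ω) :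
    ∃ r > 0, Metric.ball z₀ r ⊆ Ω ∧
      ∃ M : ℝ, ∀ z ∈ Metric.ball z₀ r, ∀ w ∈ K, ‖dslope F z w‖ ≤ M := by
  obtain ⟨r, hr, hsub⟩ := Metric.nhds_basis_closedBall.mem_iff.1 (hΩ.mem_nhds hz₀)
  have hr2 : 0 < r / 2 := by positivity
  have hsub2 : Metric.ball z₀ (r / 2) ⊆ Metric.closedBall z₀ r :=
    Metric.ball_subset_closedBall.trans (Metric.closedBall_subset_closedBall (by linarith))
  obtain ⟨M₁, h1⟩ := hK.exists_bound_of_continuousOn (hF.continuousOn.mono hKΩ)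
  obtain ⟨M₂, h2⟩ := (isCompact_closedBall z₀ r).exists_bound_of_continuousOn
    (hF.continuousOn.mono hsub)
  obtain ⟨M₃, h3⟩ := (isCompact_closedBall z₀ r).exists_bound_of_continuousOn
    ((hF.deriv hΩ).continuousOn.mono hsub)
  refine ⟨r / 2, hr2, hsub2.trans hsub, max M₃ ((r / 2)⁻¹ * (M₁ + M₂)), fun z hz w hw => ?_⟩
  by_cases hwr : w ∈ Metric.closedBall z₀ r
  · refine le_max_of_le_left ?_
    rcases eq_or_ne w z with rfl | hne
    · rw [dslope_same]
      exact h3 _ hwr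
    · have h := (convex_closedBall z₀ r).norm_image_sub_le_of_norm_deriv_le
        (fun x hx => hF.differentiableAt (hΩ.mem_nhds (hsub hx))) h3 (hsub2 hz) hwr
      rw [dslope_of_ne _ hne, slope_def_module, norm_smul, norm_inv,
        inv_mul_le_iff₀ (norm_pos_iff.2 (sub_ne_zero.2 hne)), mul_comm]
      exact h
  · refine le_max_of_le_right ?_
    have hd : r / 2 ≤ ‖w - z‖ := by
      rw [Metric.mem_closedBall, not_le] at hwr
      rw [Metric.mem_ball] at hz
      have := dist_triangle w z z₀
      rw [← dist_eq_norm]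
      linarith
    have hne : w ≠ z := fun h => by
      rw [h, sub_self, norm_zero] at hd
      linarith
    rw [dslope_of_ne _ hne, slope_def_module, norm_smul, norm_inv]
    exact mul_le_mul (inv_anti₀ hr2 hd)
      ((norm_sub_le _ _).trans (add_le_add (h1 w hw) (h2 z (hsub2 hz)))) (norm_nonneg _)
      (by positivity)

theorem integral_dslope_eq_sub [CompleteSpace E] {F : ℂ → E} (hF : ContinuousOn F C.support)
    {a : ℂ} (ha : a ∉ C.support) : C.integral (dslope F a) =
      C.integral (fun z => (z - a)⁻¹ • F z) - C.index a • F a := by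
  have h1 := continuousOn_inv_sub ha
  have h2 : C.integral (dslope F a) =
      C.integral fun z => (z - a)⁻¹ • F z - (z - a)⁻¹ • F a := by
    refine integral_congr fun w hw => ?_
    have hne : w ≠ a := fun h => ha (h ▸ hw)
    simp only [dslope_of_ne _ hne, slope_def_module, smul_sub]
  rw [h2, integral_sub (h1.fun_smul hF) (h1.fun_smul continuousOn_const), integral_smul_const]
  rfl

/-- The core of Dixon's proof of Cauchy's theorem: the difference quotients of a holomorphic
function have zero integral over a cycle whose index vanishes off the domain. -/
theorem integral_dslope_eq_zero [CompleteSpace E] {F : ℂ → E} {Ω : Set ℂ} (hΩ : IsOpen Ω)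
    (hF : DifferentiableOn ℂ F Ω) (hC : C.support ⊆ Ω) (hind : ∀ z ∉ Ω, C.index z = 0)
    {a : ℂ} (ha : a ∈ Ω) : C.integral (dslope F a) = 0 := by
  classical
  have hFc : ContinuousOn F C.support := hF.continuousOn.mono hC
  -- `h` is entire and tends to zero at infinity
  set h : ℂ → E := fun z => if z ∈ Ω then C.integral (dslope F z) else
    C.integral fun w => (w - z)⁻¹ • F w with hh
  have hslope : ∀ z ∈ Ω, ContinuousOn (dslope F z) C.support := fun z hz =>
    ((continuousOn_dslope (hΩ.mem_nhds hz)).2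
      ⟨hF.continuousOn, hF.differentiableAt (hΩ.mem_nhds hz)⟩).mono hC
  -- off the cycle, where the index vanishes, both formulas agree
  have hout : ∀ z, z ∉ C.support → C.index z = 0 →
      h z = C.integral fun w => (w - z)⁻¹ • F w := by
    intro z hz hi
    by_cases hzΩ : z ∈ Ω
    · simp only [hh, hzΩ, if_true]
      rw [integral_dslope_eq_sub hFc hz, hi, zero_smul, sub_zero]
    · simp only [hh, hzΩ, if_false]
  have hdiff : Differentiable ℂ h := by
    intro z₀
    by_cases hz₀ : z₀ ∈ Ω
    · obtain ⟨r, hr, hsub, M, hM⟩ :=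
        exists_norm_dslope_le hΩ hF C.isCompact_support hC hz₀
      have key := hasDerivAt_integral_param (C := C) (Φ := fun z w => dslope F z w) hr
        (fun z hz => hslope z (hsub hz))
        (fun w hw => by
          simp only [dslope_comm F _ w]
          exact ((Complex.differentiableOn_dslope (hΩ.mem_nhds (hC hw))).2 hF).mono hsub) hM
      refine (key.congr_of_eventuallyEq ?_).differentiableAt
      filter_upwards [hΩ.mem_nhds hz₀] with z hz
      simp only [hh, hz, if_true]
    · have hz₁ : z₀ ∉ C.support := fun h => hz₀ (hC h)
      refine ((hasDerivAt_cauchyTransform hFc hz₁).congr_of_eventuallyEq ?_).differentiableAt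
      obtain ⟨r, hr, hsub⟩ := Metric.isOpen_iff.1 C.isCompact_support.isClosed.isOpen_compl z₀ hz₁
      filter_upwards [Metric.ball_mem_nhds z₀ hr] with z hz
      refine hout z (hsub hz) ?_
      rw [index_eq_of_convex (convex_ball z₀ r) Metric.isOpen_ball
        (Set.disjoint_left.2 hsub) hz (Metric.mem_ball_self hr)]
      exact hind z₀ hz₀
  have hlim : Tendsto h (cocompact ℂ) (𝓝 0) := by
    obtain ⟨R, hR⟩ := C.isCompact_support.isBounded.subset_ball 0
    obtain ⟨M, hM⟩ := C.isCompact_support.exists_bound_of_continuousOn hFc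
    obtain ⟨L, hL⟩ := C.exists_norm_integral_le E
    have hlarge : ∀ᶠ z in cocompact ℂ, R < ‖z‖ :=
      (tendsto_norm_cocompact_atTop (E := ℂ)).eventually_gt_atTop R
    have ht : Tendsto (fun z : ℂ => L * ((‖z‖ - R)⁻¹ * M)) (cocompact ℂ) (𝓝 0) := by
      have h1 : Tendsto (fun z : ℂ => (‖z‖ - R)⁻¹) (cocompact ℂ) (𝓝 0) :=
        tendsto_inv_atTop_zero.comp
          (tendsto_atTop_add_const_right _ (-R) (tendsto_norm_cocompact_atTop (E := ℂ)))
      simpa using (h1.mul_const M).const_mul L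
    refine squeeze_zero_norm' ?_ ht
    filter_upwards [hlarge] with z hz
    have hzC : z ∉ C.support := fun h => by
      have := hR h
      rw [mem_ball_zero_iff] at this
      linarith
    rw [hout z hzC (index_eq_zero_of_support_subset_ball hR hz.le)]
    refine hL _ _ fun w hw => ?_
    have hw' : ‖w‖ < R := by simpa using hR hw
    rw [norm_smul, norm_inv]
    refine mul_le_mul (inv_anti₀ (by linarith) ?_) (hM w hw) (norm_nonneg _)
      (inv_nonneg.2 (by linarith))
    rw [norm_sub_rev]
    linarith [norm_sub_norm_le z w]
  have := hdiff.apply_eq_of_tendsto_cocompact a hlim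
  simpa only [hh, ha, if_true] using this

/-- The homological form of Cauchy's theorem. -/
theorem integral_eq_zero [CompleteSpace E] {F : ℂ → E} {Ω : Set ℂ} (hΩ : IsOpen Ω)
    (hF : DifferentiableOn ℂ F Ω) (hC : C.support ⊆ Ω) (hind : ∀ z ∉ Ω, C.index z = 0) :
    C.integral F = 0 := by
  rcases isEmpty_or_nonempty ι with hι | ⟨⟨i⟩⟩
  · simp [integral]
  · have ha : C.curve i 0 ∈ Ω := hC (C.curve_mem_support i (Set.left_mem_Icc.2 zero_le_one))
    set a := C.curve i 0
    -- `F` is the difference quotient at `a` of `z ↦ (z - a) F(z)`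
    rw [← integral_dslope_eq_zero (F := fun z => (z - a) • F z) hΩ
      ((differentiableOn_id.sub_const a).smul hF) hC hind ha]
    refine integral_congr fun w hw => ?_
    rcases eq_or_ne w a with rfl | hne
    · have h1 := ((hasDerivAt_id' a).sub_const a).fun_smul
        (hF.differentiableAt (hΩ.mem_nhds ha)).hasDerivAt
      rw [dslope_same]
      simpa using h1.deriv.symm
    · rw [dslope_of_ne _ hne, slope_def_module]
      simp [smul_smul, inv_mul_cancel₀ (sub_ne_zero.2 hne)]

/-- The homological form of Cauchy's integral formula. -/
theorem integral_inv_sub_smul [CompleteSpace E] {F : ℂ → E} {Ω : Set ℂ} (hΩ : IsOpen Ω)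
    (hF : DifferentiableOn ℂ F Ω) (hC : C.support ⊆ Ω) (hind : ∀ z ∉ Ω, C.index z = 0)
    {a : ℂ} (ha : a ∈ Ω) (haC : a ∉ C.support) :
    C.integral (fun z => (z - a)⁻¹ • F z) = C.index a • F a := by
  rw [← sub_eq_zero, ← integral_dslope_eq_sub (hF.continuousOn.mono hC) haC]
  exact integral_dslope_eq_zero hΩ hF hC hind ha

end WeightedCycle

/-! ### Contours as cycles -/

namespace WeightedCycle

variable {ι κ : Type*} [Fintype ι] [Fintype κ]
  {E : Type*} [NormedAddCommGroup E] [NormedSpace ℂ E]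

/-- The formal difference of two cycles. -/
def sub (C : WeightedCycle ι) (D : WeightedCycle κ) : WeightedCycle (ι ⊕ κ) where
  curve := Sum.elim C.curve D.curve
  weight := Sum.elim C.weight fun i => -D.weight i
  contDiffOn_curve := by
    rintro (i | i)
    exacts [C.contDiffOn_curve i, D.contDiffOn_curve i]
  sum_boundary g := by
    simp [Fintype.sum_sum_type, C.sum_boundary g, D.sum_boundary g]

theorem support_sub (C : WeightedCycle ι) (D : WeightedCycle κ) :
    (C.sub D).support = C.support ∪ D.support := by
  simp [support, sub, Set.iUnion_sum]

theorem integral_cycle_sub (C : WeightedCycle ι) (D : WeightedCycle κ) (F : ℂ → E) :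
    (C.sub D).integral F = C.integral F - D.integral F := by
  simp [integral, sub, Fintype.sum_sum_type, sub_eq_add_neg]

end WeightedCycle

namespace Contour

variable {E : Type*} [NormedAddCommGroup E] [NormedSpace ℂ E] (Γ : Contour)

/-- A contour as a cycle: all arcs have multiplicity one. -/
noncomputable def toCycle : WeightedCycle (Fin Γ.n) where
  curve i := (Γ.arc i).extend
  weight _ := 1
  contDiffOn_curve := Γ.contDiffOn_arc
  sum_boundary g := by
    simp [Γ.tgt_eq, Equiv.sum_comp Γ.next fun i => g (Γ.src i)]

theorem support_toCycle : Γ.toCycle.support = Γ.trace := by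
  refine Set.iUnion_congr fun i => ?_
  exact (Γ.arc i).image_extend_of_subset subset_rfl

theorem integral_toCycle (F : ℂ → E) : Γ.toCycle.integral F = Γ.integral F := by
  refine Finset.sum_congr rfl fun i _ => ?_
  simp only [curveIntegral_def, curveIntegralFun_def,
    ContinuousLinearMap.toSpanSingleton_apply]
  exact one_smul _ _

theorem index_toCycle (z : ℂ) :
    Γ.toCycle.index z = 2 * Real.pi * Complex.I * Γ.windingNumber z := by
  rw [WeightedCycle.index, integral_toCycle, windingNumber,
    mul_inv_cancel_left₀ Complex.two_pi_I_ne_zero]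

end Contour

/-! ### Spectral mapping for the Riesz–Dunford integral in a Banach algebra -/

section BanachAlgebra

variable {𝔸 : Type*} [NormedRing 𝔸] [NormedAlgebra ℂ 𝔸]

/-- Commutants are closed under inverses. -/
theorem isUnit_centralizer_iff {R A : Type*} [CommSemiring R] [Ring A] [Algebra R A] (s : Set A)
    (x : Subalgebra.centralizer R s) : IsUnit x ↔ IsUnit (x : A) := by
  refine ⟨fun h => h.map (Subalgebra.centralizer R s).val, ?_⟩
  rintro ⟨u, hu⟩
  have hinv : (↑u⁻¹ : A) ∈ Subalgebra.centralizer R s := by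
    rw [Subalgebra.mem_centralizer_iff]
    intro y hy
    have h := Subalgebra.mem_centralizer_iff R |>.1 x.2 y hy
    rw [← hu] at h
    exact (Commute.units_inv_right (h : Commute y u))
  refine ⟨⟨x, ⟨_, hinv⟩, ?_, ?_⟩, rfl⟩ <;> ext <;> simp [← hu]

theorem resolvent_mem_centralizer (T : 𝔸) {z : ℂ} (hz : z ∉ spectrum ℂ T) :
    resolvent T z ∈ Set.centralizer (Set.centralizer {T}) := by
  obtain ⟨u, hu⟩ := spectrum.notMem_iff.1 hz
  intro X hX
  have hX : Commute X T := (Set.mem_centralizer_iff.1 hX T rfl).symm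
  rw [resolvent, ← hu, Ring.inverse_unit]
  have h : Commute X (u : 𝔸) := hu ▸ (Algebra.commute_algebraMap_right z X).sub_right hX
  exact h.units_inv_right

variable [CompleteSpace 𝔸]

/-- Gelfand theory in the double commutant of `T`. The characters of this commutative Banach algebra
are extended by Hahn–Banach to continuous functionals on `𝔸`, so that they can be applied to
integrals in `𝔸`. -/
theorem mem_spectrum_iff_exists_multiplicative (T : 𝔸) {A : 𝔸}
    (hA : A ∈ Set.centralizer (Set.centralizer {T})) {z : ℂ} :
    z ∈ spectrum ℂ A ↔ ∃ ψ : 𝔸 →L[ℂ] ℂ, ψ 1 = 1 ∧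
      (∀ x ∈ Set.centralizer (Set.centralizer {T}), ∀ y ∈ Set.centralizer (Set.centralizer {T}),
        ψ (x * y) = ψ x * ψ y) ∧ ψ A = z := by
  let D := Subalgebra.centralizer ℂ (Set.centralizer {T})
  have hcomm : ∀ x y : D, x * y = y * x := fun x y => Subtype.ext <|
    Set.centralizer_centralizer_comm_of_comm (by rintro _ rfl _ rfl; rfl) _ x.2 _ y.2
  let _ : NormedCommRing D := { (inferInstance : NormedRing D) with mul_comm := hcomm }
  have : CompleteSpace D :=
    (Set.isClosed_centralizer (Set.centralizer {T})).completeSpace_coe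
  have hspec : z ∈ spectrum ℂ A ↔ z ∈ spectrum ℂ (⟨A, hA⟩ : D) := by
    rw [spectrum.mem_iff, spectrum.mem_iff, not_iff_not, isUnit_centralizer_iff]
    rfl
  rw [hspec]
  constructor
  · intro hz
    obtain ⟨φ, hφ⟩ := WeakDual.CharacterSpace.mem_spectrum_iff_exists.1 hz
    obtain ⟨ψ, hψ, -⟩ := exists_extension_norm_eq (𝕜 := ℂ) (E := 𝔸) D.toSubmodule
      (WeakDual.CharacterSpace.toCLM φ)
    have h : ∀ x (hx : x ∈ D), ψ x = φ ⟨x, hx⟩ := fun x hx => hψ ⟨x, hx⟩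
    refine ⟨ψ, ?_, fun x hx y hy => ?_, (h A hA).trans hφ⟩
    · rw [h 1 (one_mem D)]
      exact map_one φ
    · rw [h x hx, h y hy, h _ (mul_mem (S := Subalgebra ℂ 𝔸) (s := D) hx hy)]
      exact map_mul φ ⟨x, hx⟩ ⟨y, hy⟩
  · rintro ⟨ψ, h1, hmul, rfl⟩ hu
    obtain ⟨u, hu⟩ : IsUnit (algebraMap ℂ D (ψ A) - ⟨A, hA⟩) :=
      spectrum.mem_resolventSet_iff.1 hu
    have h := hmul _ (u : D).2 _ ((u⁻¹ : Dˣ) : D).2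
    have h2 : ((u : D) : 𝔸) * ((u⁻¹ : Dˣ) : D) = 1 := congrArg Subtype.val u.mul_inv
    have h3 : ((u : D) : 𝔸) = ψ A • (1 : 𝔸) - A := by
      rw [hu, ← Algebra.algebraMap_eq_smul_one]
      rfl
    rw [h2, h1, h3, map_sub, map_smul, h1, smul_eq_mul, mul_one, sub_self, zero_mul] at h
    exact one_ne_zero h

theorem differentiableOn_smul_resolvent (T : 𝔸) {f : ℂ → ℂ} {U : Set ℂ}
    (hf : DifferentiableOn ℂ f U) :
    DifferentiableOn ℂ (fun z => f z • resolvent T z) (U \ spectrum ℂ T) :=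
  (hf.mono Set.sdiff_subset).fun_smul fun _ hz =>
    (spectrum.hasDerivAt_resolvent_const_left
      (spectrum.notMem_iff.1 hz.2)).differentiableAt.differentiableWithinAt

/-- The spectral mapping theorem for the Riesz–Dunford integral over a cycle which surrounds the
spectrum of `T` in `U`. -/
theorem spectrum_integral_resolvent (T : 𝔸) {ι : Type*} [Fintype ι] {C : WeightedCycle ι}
    {U : Set ℂ} (hU : IsOpen U) {f : ℂ → ℂ} (hf : DifferentiableOn ℂ f U) (hTU : spectrum ℂ T ⊆ U)
    (hC : C.support ⊆ U \ spectrum ℂ T)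
    (hone : ∀ z ∈ spectrum ℂ T, C.index z = 2 * Real.pi * Complex.I)
    (hzero : ∀ z ∉ U, C.index z = 0) :
    spectrum ℂ ((2 * Real.pi * Complex.I : ℂ)⁻¹ • C.integral fun z => f z • resolvent T z) =
      f '' spectrum ℂ T := by
  set A : 𝔸 := (2 * Real.pi * Complex.I : ℂ)⁻¹ • C.integral fun z => f z • resolvent T z with hAdef
  have hcont : ContinuousOn (fun z => f z • resolvent T z) C.support :=
    (differentiableOn_smul_resolvent T hf).continuousOn.mono hC
  have hTmem : T ∈ Set.centralizer (Set.centralizer {T}) :=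
    Set.subset_centralizer_centralizer rfl
  have hA : A ∈ Set.centralizer (Set.centralizer {T}) := by
    intro X hX
    have h1 := (ContinuousLinearMap.mul ℂ 𝔸 X).weightedCycle_integral_comm hcont
    have h2 := ((ContinuousLinearMap.mul ℂ 𝔸).flip X).weightedCycle_integral_comm hcont
    rw [hAdef, mul_smul_comm, smul_mul_assoc]
    refine congrArg _ (Eq.trans h1.symm (Eq.trans (WeightedCycle.integral_congr fun z hz => ?_) h2))
    simp [resolvent_mem_centralizer T (hC hz).2 X hX]
  -- a functional that is multiplicative on the double commutant maps `f(T)` to `f(ψ(T))`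
  have key : ∀ ψ : 𝔸 →L[ℂ] ℂ, ψ 1 = 1 →
      (∀ x ∈ Set.centralizer (Set.centralizer {T}), ∀ y ∈ Set.centralizer (Set.centralizer {T}),
        ψ (x * y) = ψ x * ψ y) → ψ A = f (ψ T) := by
    intro ψ h1 hmul
    have hψT : ψ T ∈ spectrum ℂ T :=
      (mem_spectrum_iff_exists_multiplicative T hTmem).2 ⟨ψ, h1, hmul, rfl⟩
    have hres : ∀ z ∈ C.support, ψ (f z • resolvent T z) = (z - ψ T)⁻¹ • f z := by
      intro z hz
      have hR := resolvent_mem_centralizer T (hC hz).2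
      have h : T * resolvent T z = z • resolvent T z - 1 := by
        have := Ring.mul_inverse_cancel _ (spectrum.notMem_iff.1 (hC hz).2)
        rw [sub_mul, Algebra.algebraMap_eq_smul_one, smul_mul_assoc, one_mul] at this
        rw [← this, resolvent, Algebra.algebraMap_eq_smul_one, sub_sub_cancel]
      have h2 := hmul T hTmem _ hR
      rw [h, map_sub, map_smul, h1, smul_eq_mul] at h2
      have hne : z - ψ T ≠ 0 := fun h0 => (hC hz).2 (sub_eq_zero.1 h0 ▸ hψT)
      rw [map_smul, smul_eq_mul, smul_eq_mul, mul_comm]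
      congr 1
      refine eq_inv_of_mul_eq_one_left ?_
      linear_combination h2
    rw [hAdef, map_smul, ← ψ.weightedCycle_integral_comm hcont, WeightedCycle.integral_congr hres,
      WeightedCycle.integral_inv_sub_smul hU hf (hC.trans Set.sdiff_subset) hzero (hTU hψT)
        fun h => (hC h).2 hψT, hone _ hψT, smul_eq_mul, smul_eq_mul,
      inv_mul_cancel_left₀ Complex.two_pi_I_ne_zero]
  ext z
  rw [mem_spectrum_iff_exists_multiplicative T hA]
  constructor
  · rintro ⟨ψ, h1, hmul, rfl⟩
    exact ⟨ψ T, (mem_spectrum_iff_exists_multiplicative T hTmem).2 ⟨ψ, h1, hmul, rfl⟩,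
      (key ψ h1 hmul).symm⟩
  · rintro ⟨w, hw, rfl⟩
    obtain ⟨ψ, h1, hmul, rfl⟩ := (mem_spectrum_iff_exists_multiplicative T hTmem).1 hw
    exact ⟨ψ, h1, hmul, key ψ h1 hmul⟩

end BanachAlgebra

/-! ### Independence of the contour and the spectrum of `f(T)` -/

section FunctionOfOperator

variable {H : Type*} [NormedAddCommGroup H] [InnerProductSpace ℂ H] {T : H →L[ℂ] H} {f : ℂ → ℂ}

theorem Contour.Surrounds.index_toCycle_eq {Γ : Contour} {K U : Set ℂ} (h : Γ.Surrounds K U)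
    {z : ℂ} (hz : z ∈ K) : Γ.toCycle.index z = 2 * Real.pi * Complex.I := by
  rw [Γ.index_toCycle, h.windingNumber_eq_one z hz, mul_one]

theorem Contour.Surrounds.index_toCycle_eq_zero {Γ : Contour} {K U : Set ℂ}
    (h : Γ.Surrounds K U) {z : ℂ} (hz : z ∉ U) : Γ.toCycle.index z = 0 := by
  rw [Γ.index_toCycle, h.windingNumber_eq_zero z hz, mul_zero]

variable [CompleteSpace H]

theorem IsFunctionOfOperator.unique {A B : H →L[ℂ] H} (hA : IsFunctionOfOperator T f A)
    (hB : IsFunctionOfOperator T f B) : A = B := by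
  obtain ⟨U, Γ, hU, hTU, hf, hΓ, rfl⟩ := hA
  obtain ⟨V, Δ, hV, hTV, hg, hΔ, rfl⟩ := hB
  refine congrArg ((2 * Real.pi * Complex.I : ℂ)⁻¹ • ·) ?_
  rw [← Γ.integral_toCycle, ← Δ.integral_toCycle, ← sub_eq_zero, ← WeightedCycle.integral_cycle_sub]
  have hfg : DifferentiableOn ℂ f (U ∪ V) := fun z hz =>
    (hz.elim (hf z) (hg z)).differentiableAt.differentiableWithinAt
  refine WeightedCycle.integral_eq_zero ((hU.union hV).sdiff (spectrum.isClosed T))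
    (differentiableOn_smul_resolvent T hfg) ?_ fun z hz => ?_
  · rw [WeightedCycle.support_sub, Γ.support_toCycle, Δ.support_toCycle]
    exact Set.union_subset
      (hΓ.trace_subset.trans (Set.sdiff_subset_sdiff_left Set.subset_union_left))
      (hΔ.trace_subset.trans (Set.sdiff_subset_sdiff_left Set.subset_union_right))
  · rw [WeightedCycle.index, WeightedCycle.integral_cycle_sub]
    change Γ.toCycle.index z - Δ.toCycle.index z = 0
    by_cases hzT : z ∈ spectrum ℂ T
    · rw [hΓ.index_toCycle_eq hzT, hΔ.index_toCycle_eq hzT, sub_self]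
    · have hzU : z ∉ U := fun h => hz ⟨Or.inl h, hzT⟩
      have hzV : z ∉ V := fun h => hz ⟨Or.inr h, hzT⟩
      rw [hΓ.index_toCycle_eq_zero hzU, hΔ.index_toCycle_eq_zero hzV, sub_self]

theorem IsFunctionOfOperator.spectrum_eq {A : H →L[ℂ] H} (hA : IsFunctionOfOperator T f A) :
    spectrum ℂ A = f '' spectrum ℂ T := by
  obtain ⟨U, Γ, hU, hTU, hf, hΓ, rfl⟩ := hA
  rw [Contour.rieszDunford, ← Γ.integral_toCycle]
  exact spectrum_integral_resolvent T hU hf.differentiableOn hTU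
    (Γ.support_toCycle.trans_subset hΓ.trace_subset) (fun z hz => hΓ.index_toCycle_eq hz)
    fun z hz => hΓ.index_toCycle_eq_zero hz

end FunctionOfOperator

/-! ### Square grids -/

/-- If every point is the initial point of as many edges as it is the end point of, the edges can
be joined to closed curves. -/
theorem exists_perm_of_sum_eq {ι α : Type*} [Fintype ι] (src tgt : ι → α)
    (h : ∀ g : α → ℤ, ∑ i, g (tgt i) = ∑ i, g (src i)) :
    ∃ σ : Equiv.Perm ι, ∀ i, tgt i = src (σ i) := by
  classical
  have hcard : ∀ a, Fintype.card {i // tgt i = a} = Fintype.card {i // src i = a} := by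
    intro a
    have := h fun x => if x = a then 1 else 0
    simp only [Finset.sum_boole] at this
    rw [Fintype.card_subtype, Fintype.card_subtype]
    exact_mod_cast this
  refine ⟨Equiv.ofFiberEquiv fun a => Fintype.equivOfCardEq (hcard a), fun i => ?_⟩
  exact (Equiv.ofFiberEquiv_map _ i).symm

theorem Convex.reProdIm {s t : Set ℝ} (hs : Convex ℝ s) (ht : Convex ℝ t) : Convex ℝ (s ×ℂ t) :=
  (hs.linear_preimage Complex.reLm).inter (ht.linear_preimage Complex.imLm)

/-- The outward normals `1, i, -1, -i` of the four edges of a square. -/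
def gridDir : Fin 4 → GaussianInt := ![1, ⟨0, 1⟩, -1, ⟨0, -1⟩]

theorem gridDir_toComplex (k : Fin 4) :
    (gridDir k : ℂ) = ![1, Complex.I, -1, -Complex.I] k := by
  fin_cases k <;> simp [gridDir, GaussianInt.toComplex_def]

theorem gridDir_add_one (k : Fin 4) : (gridDir (k + 1) : ℂ) = Complex.I * gridDir k := by
  fin_cases k <;> simp [gridDir_toComplex]

theorem gridDir_add_two (k : Fin 4) : gridDir (k + 2) = -gridDir k := by
  fin_cases k <;> rfl

theorem conj_gridDir_mul (k : Fin 4) :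
    (starRingEnd ℂ) (gridDir k : ℂ) * (gridDir k : ℂ) = 1 := by
  fin_cases k <;> simp [gridDir_toComplex]

/-- The edges on the boundary of the union of a finite set of grid squares. A square is given by a
Gaussian integer `s`, and the pair `(s, k)` stands for its edge with the outward normal `gridDir k`,
oriented counterclockwise; the square across this edge is `s + gridDir k`. -/
def gridBoundary (S : Finset GaussianInt) : Finset (GaussianInt × Fin 4) :=
  {p ∈ S ×ˢ Finset.univ | p.1 + gridDir p.2 ∉ S}

theorem mem_gridBoundary {S : Finset GaussianInt} {p : GaussianInt × Fin 4} :
    p ∈ gridBoundary S ↔ p.1 ∈ S ∧ p.1 + gridDir p.2 ∉ S := by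
  simp [gridBoundary]

/-- The inner edges cancel: a function of the edges that changes sign when an edge is considered as
an edge of the neighbouring square has the same sum over the boundary edges as over all edges of
all squares. -/
theorem sum_gridBoundary {A : Type*} [AddCommGroup A] (φ : GaussianInt → Fin 4 → A)
    (hφ : ∀ s k, φ (s + gridDir k) (k + 2) = -φ s k) (S : Finset GaussianInt) :
    ∑ p ∈ gridBoundary S, φ p.1 p.2 = ∑ s ∈ S, ∑ k, φ s k := by
  rw [← Finset.sum_product', gridBoundary, ← Finset.sum_filter_add_sum_filter_not (S ×ˢ Finset.univ)
    (fun p : GaussianInt × Fin 4 => p.1 + gridDir p.2 ∉ S), left_eq_add]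
  have hne : ∀ k : Fin 4, k + 2 ≠ k := by decide
  have hinv : ∀ k : Fin 4, k + 2 + 2 = k := by decide
  refine Finset.sum_involution (fun p _ => (p.1 + gridDir p.2, p.2 + 2)) ?_ ?_ ?_ ?_
  · rintro ⟨s, k⟩ -
    simp [hφ]
  · rintro ⟨s, k⟩ - - h
    exact hne k (congrArg Prod.snd h)
  · rintro ⟨s, k⟩ h
    simp only [Finset.mem_filter, Finset.mem_product, Finset.mem_univ, and_true, not_not] at h
    simp [gridDir_add_two, h]
  · rintro ⟨s, k⟩ -
    simp [gridDir_add_two, hinv]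

section Grid

variable (δ : ℝ)

/-- The initial point of the edge `k` of the square with centre `δ s` and side `δ`. Addition in
`Fin 4` is cyclic, so the end point is the corner `k + 1`. -/
noncomputable def gridCorner (s : GaussianInt) (k : Fin 4) : ℂ :=
  δ * (s + (1 - Complex.I) / 2 * gridDir k)

theorem gridCorner_add_one (s : GaussianInt) (k : Fin 4) :
    gridCorner δ s (k + 1) = δ * (s + (1 + Complex.I) / 2 * gridDir k) := by
  rw [gridCorner, gridDir_add_one]
  linear_combination (-(δ : ℂ) / 2 * gridDir k) * Complex.I_mul_I

theorem gridCorner_neighbour (s : GaussianInt) (k : Fin 4) :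
    gridCorner δ (s + gridDir k) (k + 2) = gridCorner δ s (k + 1) := by
  rw [gridCorner_add_one, gridCorner, gridDir_add_two, GaussianInt.toComplex_add,
    GaussianInt.toComplex_neg]
  ring

theorem gridCorner_neighbour_add_one (s : GaussianInt) (k : Fin 4) :
    gridCorner δ (s + gridDir k) (k + 2 + 1) = gridCorner δ s k := by
  rw [gridCorner_add_one, gridCorner, gridDir_add_two, GaussianInt.toComplex_add,
    GaussianInt.toComplex_neg]
  ring

/-- The closed square with centre `δ s` and side `δ`. -/
def gridClosedSquare (s : GaussianInt) : Set ℂ :=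
  Set.Icc (δ * (s.re - 1 / 2)) (δ * (s.re + 1 / 2)) ×ℂ
    Set.Icc (δ * (s.im - 1 / 2)) (δ * (s.im + 1 / 2))

/-- The open square with centre `δ s` and side `δ`. -/
def gridOpenSquare (s : GaussianInt) : Set ℂ :=
  Set.Ioo (δ * (s.re - 1 / 2)) (δ * (s.re + 1 / 2)) ×ℂ
    Set.Ioo (δ * (s.im - 1 / 2)) (δ * (s.im + 1 / 2))

variable {δ}

theorem gridCorner_mem (hδ : 0 < δ) (s : GaussianInt) (k : Fin 4) :
    gridCorner δ s k ∈ gridClosedSquare δ s := by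
  fin_cases k <;>
    simp [gridCorner, gridClosedSquare, gridDir_toComplex, Complex.mem_reProdIm, hδ]
  all_goals norm_num
  · linarith
  · constructor <;> linarith
  · linarith

theorem center_mem_gridOpenSquare (hδ : 0 < δ) (s : GaussianInt) :
    (δ * s : ℂ) ∈ gridOpenSquare δ s := by
  simp [gridOpenSquare, Complex.mem_reProdIm, hδ]

theorem segment_gridCorner_subset (hδ : 0 < δ) (s : GaussianInt) (k : Fin 4) :
    segment ℝ (gridCorner δ s k) (gridCorner δ s (k + 1)) ⊆ gridClosedSquare δ s :=
  ((convex_Icc _ _).reProdIm (convex_Icc _ _)).segment_subset (gridCorner_mem hδ s k)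
    (gridCorner_mem hδ s (k + 1))

theorem exists_mem_gridClosedSquare (hδ : 0 < δ) (z : ℂ) : ∃ s, z ∈ gridClosedSquare δ s := by
  refine ⟨⟨round (z.re / δ), round (z.im / δ)⟩, ?_⟩
  have key : ∀ x : ℝ, x ∈ Set.Icc (δ * (round (x / δ) - 1 / 2)) (δ * (round (x / δ) + 1 / 2)) := by
    intro x
    have h := abs_le.1 (abs_sub_round (x / δ))
    have hx : x = δ * (x / δ) := by field_simp
    constructor
    · exact (mul_le_mul_of_nonneg_left (by linarith) hδ.le).trans_eq hx.symm
    · exact hx.trans_le (mul_le_mul_of_nonneg_left (by linarith) hδ.le)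
  exact ⟨key _, key _⟩

theorem closure_gridOpenSquare (hδ : 0 < δ) (s : GaussianInt) :
    closure (gridOpenSquare δ s) = gridClosedSquare δ s := by
  rw [gridOpenSquare, Complex.closure_reProdIm, closure_Ioo, closure_Ioo, gridClosedSquare] <;>
    nlinarith

theorem norm_sub_le_of_mem_gridClosedSquare {s : GaussianInt} {z w : ℂ}
    (hz : z ∈ gridClosedSquare δ s) (hw : w ∈ gridClosedSquare δ s) : ‖z - w‖ ≤ 2 * δ := by
  refine (Complex.norm_le_abs_re_add_abs_im _).trans ?_
  have h1 : |(z - w).re| ≤ δ := abs_le.2 ⟨by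
    rw [Complex.sub_re]; linarith [hz.1.1, hw.1.2], by
    rw [Complex.sub_re]; linarith [hz.1.2, hw.1.1]⟩
  have h2 : |(z - w).im| ≤ δ := abs_le.2 ⟨by
    rw [Complex.sub_im]; linarith [hz.2.1, hw.2.2], by
    rw [Complex.sub_im]; linarith [hz.2.2, hw.2.1]⟩
  linarith

theorem finite_gridClosedSquare_inter (hδ : 0 < δ) {K : Set ℂ} (hK : Bornology.IsBounded K) :
    {s | (gridClosedSquare δ s ∩ K).Nonempty}.Finite := by
  obtain ⟨R, hR⟩ := hK.subset_closedBall 0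
  obtain ⟨N, hN⟩ := exists_nat_ge (R / δ + 1 / 2)
  refine ((Set.finite_Icc (-(N : ℤ)) N).prod (Set.finite_Icc (-(N : ℤ)) N)).of_injOn
    (f := fun s : GaussianInt => (s.re, s.im)) ?_ ?_
  · rintro s ⟨z, hz, hzK⟩
    have key : ∀ (x : ℝ) (m : ℤ), x ∈ Set.Icc (δ * (m - 1 / 2)) (δ * (m + 1 / 2)) →
        |x| ≤ R → m ∈ Set.Icc (-(N : ℤ)) N := by
      intro x m hx hxR
      have h := abs_le.1 hxR
      have hRδ : δ * (R / δ) = R := by field_simp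
      have h1 : (m : ℝ) ≤ N := le_trans (le_of_mul_le_mul_left (by linarith [hx.1]) hδ) hN
      have h2 : -(m : ℝ) ≤ N := le_trans (le_of_mul_le_mul_left (by linarith [hx.2]) hδ) hN
      refine ⟨?_, by exact_mod_cast h1⟩
      have : -(m : ℤ) ≤ N := by exact_mod_cast h2
      linarith
    have hzR : ‖z‖ ≤ R := by simpa using hR hzK
    exact ⟨key _ _ hz.1 ((Complex.abs_re_le_norm z).trans hzR),
      key _ _ hz.2 ((Complex.abs_im_le_norm z).trans hzR)⟩
  · intro s _ t _ h
    exact Zsqrtd.ext (congrArg Prod.fst h) (congrArg Prod.snd h)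

variable (δ) in
/-- The boundary of the square with centre `δ s` and side `δ`, oriented counterclockwise. -/
noncomputable def gridCycle (s : GaussianInt) : WeightedCycle (Fin 4) where
  curve k t := AffineMap.lineMap (gridCorner δ s k) (gridCorner δ s (k + 1)) t
  weight _ := 1
  contDiffOn_curve k := (AffineMap.contDiff_lineMap _ _).contDiffOn
  sum_boundary g := by
    simp only [AffineMap.lineMap_apply_one, AffineMap.lineMap_apply_zero, one_mul,
      Finset.sum_sub_distrib]
    rw [sub_eq_zero]
    exact Equiv.sum_comp (Equiv.addRight (1 : Fin 4)) fun k => g (gridCorner δ s k)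

theorem support_gridCycle_subset (hδ : 0 < δ) (s : GaussianInt) :
    (gridCycle δ s).support ⊆ gridClosedSquare δ s := by
  refine Set.iUnion_subset fun k => ?_
  refine Set.Subset.trans ?_ (segment_gridCorner_subset hδ s k)
  rw [segment_eq_image_lineMap]
  rfl

/-- After a rotation that takes its outward normal to `1`, every edge runs from `δ (1 - i) / 2` to
`δ (1 + i) / 2` relative to the centre of the square. -/
theorem conj_gridDir_mul_curve_sub (s : GaussianInt) (k : Fin 4) (t : ℝ) :
    (starRingEnd ℂ) (gridDir k : ℂ) * ((gridCycle δ s).curve k t - δ * s) =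
      δ * (1 / 2 + (t - 1 / 2) * Complex.I) := by
  have h : (gridCycle δ s).curve k t = gridCorner δ s k +
    t * (gridCorner δ s (k + 1) - gridCorner δ s k) := by
    simp [gridCycle, AffineMap.lineMap_apply, add_comm]
  rw [h, gridCorner_add_one, gridCorner]
  linear_combination (δ * (1 / 2 + (t - 1 / 2) * Complex.I)) * conj_gridDir_mul k

theorem disjoint_gridOpenSquare_support (s : GaussianInt) :
    Disjoint (gridOpenSquare δ s) (gridCycle δ s).support := by
  rw [Set.disjoint_left]
  intro z hz hzs
  obtain ⟨k, t, -, rfl⟩ := Set.mem_iUnion.1 hzs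
  have h := congrArg Complex.re (conj_gridDir_mul_curve_sub (δ := δ) s k t)
  obtain ⟨⟨h1, h2⟩, h3, h4⟩ := hz
  simp only [GaussianInt.intCast_re, GaussianInt.intCast_im] at h1 h2 h3 h4
  set z := (gridCycle δ s).curve k t
  fin_cases k <;> simp [gridDir_toComplex] at h <;> linarith

/-- The increment of the logarithm along one edge of a square centred at the origin. -/
theorem log_sub_log_quarter {r : ℝ} (hr : 0 < r) :
    Complex.log (r * (1 + Complex.I)) - Complex.log (r * (1 - Complex.I)) =
      Real.pi / 2 * Complex.I := by
  have harg : Complex.arg (r * (1 + Complex.I)) = Real.pi / 4 := by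
    have h2 : (1 + Complex.I : ℂ) = (Real.sqrt 2 : ℝ) *
        (Complex.cos (Real.pi / 4 : ℝ) + Complex.sin (Real.pi / 4 : ℝ) * Complex.I) := by
      rw [← Complex.ofReal_cos, ← Complex.ofReal_sin, Real.cos_pi_div_four, Real.sin_pi_div_four]
      have : ((Real.sqrt 2 : ℝ) : ℂ) * (Real.sqrt 2 : ℝ) = 2 := by
        rw [← Complex.ofReal_mul, Real.mul_self_sqrt zero_le_two]
        norm_num
      push_cast
      linear_combination (-(1 + Complex.I) / 2) * this
    rw [Complex.arg_real_mul _ hr, h2, Complex.arg_mul_cos_add_sin_mul_I (by positivity)]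
    constructor <;> linarith [Real.pi_pos]
  have hconj : (r * (1 - Complex.I) : ℂ) = (starRingEnd ℂ) (r * (1 + Complex.I)) := by
    simp [sub_eq_add_neg]
  rw [hconj, Complex.log_conj _ (by rw [harg]; linarith [Real.pi_pos]), Complex.sub_conj,
    Complex.log_im, harg]
  push_cast
  ring

theorem index_gridCycle_center (hδ : 0 < δ) (s : GaussianInt) :
    (gridCycle δ s).index (δ * s) = 2 * Real.pi * Complex.I := by
  have hcs : (δ * s : ℂ) ∈ gridOpenSquare δ s :=
    center_mem_gridOpenSquare hδ s
  have hc : (δ * s : ℂ) ∉ (gridCycle δ s).support :=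
    Set.disjoint_left.1 (disjoint_gridOpenSquare_support s) hcs
  have hlog : ∀ k, ∫ t in (0 : ℝ)..1, derivWithin ((gridCycle δ s).curve k) (Set.Icc 0 1) t •
      ((gridCycle δ s).curve k t - δ * s)⁻¹ = Real.pi / 2 * Complex.I := by
    intro k
    have hpos : ∀ t, 0 < ((starRingEnd ℂ) (gridDir k : ℂ) *
        ((gridCycle δ s).curve k t - δ * s)).re := by
      intro t
      rw [conj_gridDir_mul_curve_sub, Complex.re_ofReal_mul]
      refine mul_pos hδ ?_
      simp
    have hne : (starRingEnd ℂ) (gridDir k : ℂ) ≠ 0 := fun h => by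
      simpa [h] using conj_gridDir_mul k
    rw [WeightedCycle.integral_curve_eq_sub (C := gridCycle δ s) k
      (G := fun z => Complex.log ((starRingEnd ℂ) (gridDir k : ℂ) * (z - δ * s)))
      (WeightedCycle.continuousOn_inv_sub hc) fun t _ => ?_]
    · simp only [conj_gridDir_mul_curve_sub]
      rw [← log_sub_log_quarter (half_pos hδ)]
      congr 2 <;> push_cast <;> ring
    · have h := (((hasDerivAt_id' ((gridCycle δ s).curve k t)).sub_const (δ * s : ℂ)).const_mul
        ((starRingEnd ℂ) (gridDir k : ℂ))).clog (Or.inl (hpos t))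
      convert h using 1
      rw [mul_one, div_mul_cancel_left₀ hne]
  rw [WeightedCycle.index, WeightedCycle.integral, Finset.sum_congr rfl fun k _ =>
    congrArg _ (hlog k)]
  simp [gridCycle]
  ring

theorem index_gridCycle (hδ : 0 < δ) {s t : GaussianInt} {z : ℂ} (hz : z ∈ gridOpenSquare δ t) :
    (gridCycle δ s).index z = if s = t then 2 * Real.pi * Complex.I else 0 := by
  split_ifs with hst
  · subst hst
    rw [← index_gridCycle_center hδ s]
    exact WeightedCycle.index_eq_of_convex ((convex_Ioo _ _).reProdIm (convex_Ioo _ _))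
      (isOpen_Ioo.reProdIm isOpen_Ioo) (disjoint_gridOpenSquare_support s) hz
      (center_mem_gridOpenSquare hδ s)
  · have hcast : ∀ {m n : ℤ}, m < n → δ * ((m : ℝ) + 1 / 2) ≤ δ * ((n : ℝ) - 1 / 2) := by
      intro m n h
      have : (m : ℝ) + 1 ≤ n := by exact_mod_cast h
      exact mul_le_mul_of_nonneg_left (by linarith) hδ.le
    obtain ⟨⟨h1, h2⟩, h3, h4⟩ := hz
    have hsupp := support_gridCycle_subset hδ s
    have hne : s.re < t.re ∨ t.re < s.re ∨ s.im < t.im ∨ t.im < s.im := by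
      by_contra! h
      exact hst (Zsqrtd.ext (le_antisymm h.2.1 h.1) (le_antisymm h.2.2.2 h.2.2.1))
    -- the closed square `s` and the point `z` are separated by a grid line
    rcases hne with h | h | h | h
    · refine WeightedCycle.index_eq_zero_of_re_pos (a := -1) fun w hw => ?_
      simp
      linarith [(hsupp hw).1.2, hcast h]
    · refine WeightedCycle.index_eq_zero_of_re_pos (a := 1) fun w hw => ?_
      simp
      linarith [(hsupp hw).1.1, hcast h]
    · refine WeightedCycle.index_eq_zero_of_re_pos (a := Complex.I) fun w hw => ?_
      simp
      linarith [(hsupp hw).2.2, hcast h]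
    · refine WeightedCycle.index_eq_zero_of_re_pos (a := -Complex.I) fun w hw => ?_
      simp
      linarith [(hsupp hw).2.1, hcast h]

end Grid

/-! ### Existence of surrounding contours -/

theorem integral_gridCycle {E : Type*} [NormedAddCommGroup E] [NormedSpace ℂ E] (δ : ℝ)
    (s : GaussianInt) (F : ℂ → E) :
    (gridCycle δ s).integral F = ∑ k, curveIntegral
      (fun z => ContinuousLinearMap.toSpanSingleton ℂ (F z))
      (Path.segment (gridCorner δ s k) (gridCorner δ s (k + 1))) := by
  refine Finset.sum_congr rfl fun k _ => ?_
  rw [curveIntegral_segment]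
  refine (one_smul ℂ _).trans (intervalIntegral.integral_congr fun t ht => ?_)
  rw [Set.uIcc_of_le zero_le_one] at ht
  simp only [gridCycle, ContinuousLinearMap.toSpanSingleton_apply]
  rw [AffineMap.hasDerivWithinAt_lineMap.derivWithin (uniqueDiffOn_Icc zero_lt_one t ht)]

theorem curveIntegral_gridEdge_neighbour {E : Type*} [NormedAddCommGroup E] [NormedSpace ℂ E]
    (δ : ℝ) (ω : ℂ → ℂ →L[ℂ] E) (s : GaussianInt) (k : Fin 4) :
    curveIntegral ω (Path.segment (gridCorner δ (s + gridDir k) (k + 2))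
      (gridCorner δ (s + gridDir k) (k + 2 + 1))) =
      -curveIntegral ω (Path.segment (gridCorner δ s k) (gridCorner δ s (k + 1))) := by
  rw [gridCorner_neighbour, gridCorner_neighbour_add_one, ← curveIntegral_symm, Path.segment_symm]

/-- The boundary of the union of a finite set of grid squares is a contour, and integrals over it
are the sums of the integrals over the boundaries of the squares. -/
theorem exists_gridContour (δ : ℝ) (S : Finset GaussianInt) :
    ∃ Γ : Contour,
      (Γ.trace = ⋃ p ∈ gridBoundary S,
        segment ℝ (gridCorner δ p.1 p.2) (gridCorner δ p.1 (p.2 + 1))) ∧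
      ∀ F : ℂ → ℂ, Γ.integral F = ∑ s ∈ S, (gridCycle δ s).integral F := by
  have e := (gridBoundary S).equivFin.symm
  obtain ⟨σ, hσ⟩ := exists_perm_of_sum_eq
    (fun i => gridCorner δ (e i).1.1 (e i).1.2) (fun i => gridCorner δ (e i).1.1 ((e i).1.2 + 1))
    fun g => by
      rw [← sub_eq_zero, ← Finset.sum_sub_distrib,
        e.sum_comp (fun p => g (gridCorner δ p.1.1 (p.1.2 + 1)) - g (gridCorner δ p.1.1 p.1.2)),
        Finset.sum_coe_sort (gridBoundary S)
          (fun p => g (gridCorner δ p.1 (p.2 + 1)) - g (gridCorner δ p.1 p.2)),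
        sum_gridBoundary (fun s k => g (gridCorner δ s (k + 1)) - g (gridCorner δ s k))]
      · refine Finset.sum_eq_zero fun s _ => ?_
        rw [Finset.sum_sub_distrib, sub_eq_zero]
        exact Equiv.sum_comp (Equiv.addRight (1 : Fin 4)) fun k => g (gridCorner δ s k)
      · intro s k
        rw [gridCorner_neighbour, gridCorner_neighbour_add_one, neg_sub]
  refine ⟨{ n := (gridBoundary S).card
            src := fun i => gridCorner δ (e i).1.1 (e i).1.2
            tgt := fun i => gridCorner δ (e i).1.1 ((e i).1.2 + 1)
            arc := fun i => Path.segment _ _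
            contDiffOn_arc := fun i => (AffineMap.contDiff_lineMap _ _).contDiffOn.congr
              (Path.eqOn_extend_segment _ _)
            next := σ
            tgt_eq := hσ }, ?_, fun F => ?_⟩
  · rw [Contour.trace]
    simp only [Path.range_segment]
    rw [e.surjective.iUnion_comp
      (fun p => segment ℝ (gridCorner δ p.1.1 p.1.2) (gridCorner δ p.1.1 (p.1.2 + 1)))]
    exact iSup_subtype
  · simp only [integral_gridCycle]
    rw [← sum_gridBoundary _ (curveIntegral_gridEdge_neighbour δ _), ← Finset.sum_coe_sort]
    exact e.sum_comp fun p => curveIntegral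
      (fun z => ContinuousLinearMap.toSpanSingleton ℂ (F z))
      (Path.segment (gridCorner δ p.1.1 p.1.2) (gridCorner δ p.1.1 (p.1.2 + 1)))

/-- A compact subset of an open set is surrounded by a contour in this set. -/
theorem exists_contour_surrounds {K U : Set ℂ} (hK : IsCompact K) (hU : IsOpen U) (hKU : K ⊆ U) :
    ∃ Γ : Contour, Γ.Surrounds K U := by
  classical
  obtain ⟨ε, hε, hεU⟩ := hK.exists_thickening_subset_open hU hKU
  -- squares of side `δ` have diameter less than `ε`
  set δ := ε / 3 with hδε
  have hδ : 0 < δ := by positivity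
  set S : Finset GaussianInt := (finite_gridClosedSquare_inter hδ hK.isBounded).toFinset
  have hS : ∀ s, s ∈ S ↔ (gridClosedSquare δ s ∩ K).Nonempty := fun s => by simp [S]
  have hSU : ∀ s ∈ S, gridClosedSquare δ s ⊆ U := by
    intro s hs z hz
    obtain ⟨w, hw, hwK⟩ := (hS s).1 hs
    refine hεU (Metric.mem_thickening_iff.2 ⟨w, hwK, ?_⟩)
    rw [dist_eq_norm]
    linarith [norm_sub_le_of_mem_gridClosedSquare hz hw]
  obtain ⟨Γ, htrace, hint⟩ := exists_gridContour δ S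
  have hsub : Γ.trace ⊆ U \ K := by
    rw [htrace]
    refine Set.iUnion₂_subset fun p hp z hz => ?_
    obtain ⟨h1, h2⟩ := mem_gridBoundary.1 hp
    refine ⟨hSU _ h1 (segment_gridCorner_subset hδ _ _ hz), fun hzK => h2 ?_⟩
    refine (hS _).2 ⟨z, segment_gridCorner_subset hδ _ (p.2 + 2) ?_, hzK⟩
    rw [gridCorner_neighbour, gridCorner_neighbour_add_one, segment_symm]
    exact hz
  -- the index about `z` is computed at a nearby point inside a square which contains `z`
  have hind : ∀ z ∉ Γ.trace, ∀ s, z ∈ gridClosedSquare δ s →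
      Γ.windingNumber z = if s ∈ S then 1 else 0 := by
    intro z hz s hzs
    rw [← Γ.support_toCycle] at hz
    obtain ⟨r, hr, hball⟩ :=
      Metric.isOpen_iff.1 Γ.toCycle.isCompact_support.isClosed.isOpen_compl z hz
    rw [← closure_gridOpenSquare hδ] at hzs
    obtain ⟨w, hw, hdist⟩ := Metric.mem_closure_iff.1 hzs r hr
    have hindex : Γ.toCycle.index z = if s ∈ S then 2 * Real.pi * Complex.I else 0 := by
      rw [WeightedCycle.index_eq_of_convex (convex_ball z r) Metric.isOpen_ball
        (Set.disjoint_left.2 hball) (Metric.mem_ball_self hr) (Metric.mem_ball'.2 hdist),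
        WeightedCycle.index, Γ.integral_toCycle, hint]
      change ∑ t ∈ S, (gridCycle δ t).index w = _
      simp only [index_gridCycle hδ hw, Finset.sum_ite_eq']
    rw [Γ.index_toCycle] at hindex
    refine mul_left_cancel₀ Complex.two_pi_I_ne_zero (hindex.trans ?_)
    split_ifs <;> simp
  refine ⟨Γ, hsub, fun z hz => ?_, fun z hz => ?_⟩
  · obtain ⟨s, hs⟩ := exists_mem_gridClosedSquare hδ z
    rw [hind z (fun h => (hsub h).2 hz) s hs, if_pos ((hS s).2 ⟨z, hs, hz⟩)]
  · obtain ⟨s, hs⟩ := exists_mem_gridClosedSquare hδ z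
    rw [hind z (fun h => hz (hsub h).1) s hs, if_neg fun h => hz (hSU s h hs)]

/-- The operator `f(T)` given by the Riesz–Dunford integral is well defined, and
`σ(f(T)) = f(σ(T))`. -/
theorem theorem2p3 {H : Type*} [NormedAddCommGroup H] [InnerProductSpace ℂ H] [CompleteSpace H]
    [TopologicalSpace.SeparableSpace H] (T : H →L[ℂ] H) (hT : IsSVTriangular T)
    (U : Set ℂ) (hU : IsOpen U) (hTU : spectrum ℂ T ⊆ U)
    (f : ℂ → ℂ) (hf : AnalyticOnNhd ℂ f U) :
    (∃! A : H →L[ℂ] H, IsFunctionOfOperator T f A) ∧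
      ∀ A : H →L[ℂ] H, IsFunctionOfOperator T f A → spectrum ℂ A = f '' spectrum ℂ T := by
  obtain ⟨Γ, hΓ⟩ := exists_contour_surrounds (spectrum.isCompact T) hU hTU
  exact ⟨⟨Γ.rieszDunford T f, ⟨U, Γ, hU, hTU, hf, hΓ, rfl⟩,
    fun B hB => hB.unique ⟨U, Γ, hU, hTU, hf, hΓ, rfl⟩⟩, fun A hA => hA.spectrum_eq⟩
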